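/- Let $d\in\mathbb{N}$ and let $D\subset\mathbb{R}^d$ be compact and infinite. Then there exists a function $f\colon D\to\mathbb{R}$ with $|f(x)-f(y)|\le\|x-y\|_\infty$ for all $x,y\in D$ (that is, $f\in\mathrm{Lip}_{1,\infty}(D)$) that cannot be uniformly approximated on $D$ by ReLU networks with $\infty$-norm-constrained weights. In other words, it is not the case that for every $\varepsilon>0$ there is a function $\Phi\colon\mathbb{R}^d\to\mathbb{R}$ with $\sup_{x\in D}|\Phi(x)-f(x)|\le\varepsilon$ of the form $$\Phi = A_K\circ\sigma\circ A_{K-1}\circ\sigma\circ\cdots\circ\sigma\circ A_1,\qquad A_k(x)=W_kx+b_k,$$ where the number of layers $K\ge 1$ and the widths $n_1,\dots,n_K$ (with $n_0=d$, $n_K=1$) are arbitrary, $\sigma$ is the component-wise ReLU $t\mapsto\max(t,0)$, the biases $b_k\in\mathbb{R}^{n_k}$ are arbitrary, and the weight matrices $W_k\in\mathbb{R}^{n_k\times n_{k-1}}$ satisfy $\|W_k\|_\infty=\max_{\|x\|_\infty=1}\|W_kx\|_\infty\le 1$ for all $k=1,\dots,K$. -/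

import Mathlib

noncomputable section

/-- Parameters of a fully connected feed-forward network `ℝ^d → ℝ^n` with any number `K ≥ 1` of
layers and arbitrary widths: weight matrices `W_k` and bias vectors `b_k`. The index `n` is the
width of the last layer. -/
inductive FeedForwardNet (d : ℕ) : ℕ → Type
  | affine {n : ℕ} (W : Matrix (Fin n) (Fin d) ℝ) (b : Fin n → ℝ) : FeedForwardNet d n
  | layer {m n : ℕ} (Φ : FeedForwardNet d m) (W : Matrix (Fin n) (Fin m) ℝ) (b : Fin n → ℝ) :
      FeedForwardNet d n

/-- The rectified linear unit. -/
def relu (t : ℝ) : ℝ := max t 0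

/-- The operator norm `‖W‖_∞ = max { ‖W x‖_∞ : ‖x‖_∞ = 1 }`; the norm of `Fin m → ℝ` in Mathlib
is the maximum norm. -/
def matrixInftyNorm {m n : ℕ} (W : Matrix (Fin n) (Fin m) ℝ) : ℝ :=
  ‖LinearMap.toContinuousLinearMap (Matrix.mulVecLin W)‖

namespace FeedForwardNet

/-- The map `A_K ∘ σ ∘ A_{K-1} ∘ ⋯ ∘ σ ∘ A_1` realized by a network, where `A_k x = W_k x + b_k`
and `σ` is applied component-wise. -/
def eval {d : ℕ} (σ : ℝ → ℝ) : {n : ℕ} → FeedForwardNet d n → (Fin d → ℝ) → (Fin n → ℝ)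
  | _, affine W b, x => W.mulVec x + b
  | _, layer Φ W b, x => W.mulVec (fun j => σ (eval σ Φ x j)) + b

/-- All weight matrices satisfy `‖W_k‖_∞ ≤ 1` (the biases are unconstrained). -/
def InftyNormConstrained {d : ℕ} : {n : ℕ} → FeedForwardNet d n → Prop
  | _, affine W _ => matrixInftyNorm W ≤ 1
  | _, layer Φ W _ => InftyNormConstrained Φ ∧ matrixInftyNorm W ≤ 1

end FeedForwardNet

/-- `Lip_{1,∞}(D)`: the functions `f : D → ℝ` with `|f x - f y| ≤ ‖x - y‖_∞` on `D`. -/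
def LipOneInfty {d : ℕ} (D : Set (Fin d → ℝ)) : Set (D → ℝ) :=
  {f | ∀ x y : D, |f x - f y| ≤ ‖(x : Fin d → ℝ) - (y : Fin d → ℝ)‖}

end

/-!
The obstruction to approximation is the second difference
`(Φ x - Φ y) + (Φ z - Φ y)` of a network at three points `x, y, z`. All layers of a constrained
network are 1-Lipschitz for the maximum norm. Hence the second difference of a network is bounded
by any `c` that dominates `‖x - y‖`, `‖z - y‖` and `‖(x - y) + (z - y)‖`
(`FeedForwardNet.norm_secondDiff_eval_le`): a constrained affine map does not increase the second
difference, and the ReLU preserves the bound `c` on second differences of functions that vary by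
at most `c` from `y` to `x` and from `y` to `z` (`abs_secondDiff_relu_le`).

The 1-Lipschitz function `f p = ‖p - y‖` has second difference `‖x - y‖ + ‖z - y‖`. So it is not
approximable as soon as the triple makes the triangle inequality
`‖(x - y) + (z - y)‖ ≤ ‖x - y‖ + ‖z - y‖` strict, with `x` and `z` different from `y`. Every
infinite subset of `ℝ^d` contains such a triple (`exists_norm_add_lt_of_infinite`). To see this,
color a pair of terms of an injective sequence in the set by the signed coordinates in which their
difference attains its norm; there are terms `x, y, z`, in this order, for which `(x, y)` and
`(y, z)` have the same color, and then `x - y` and `z - y` attain their norms in opposite signed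
coordinates only.
-/

/-! ### Second differences of constrained networks -/

lemma norm_mulVec_le_of_matrixInftyNorm_le_one {m n : ℕ} {W : Matrix (Fin n) (Fin m) ℝ}
    (hW : matrixInftyNorm W ≤ 1) (v : Fin m → ℝ) : ‖W.mulVec v‖ ≤ ‖v‖ :=
  ContinuousLinearMap.le_of_opNorm_le_of_le
    (LinearMap.toContinuousLinearMap (Matrix.mulVecLin W)) hW le_rfl |>.trans_eq (one_mul _)

lemma abs_relu_sub_relu_le (s t : ℝ) : |relu s - relu t| ≤ |s - t| :=
  abs_max_sub_max_le_abs s t 0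

/-- The ReLU may turn a linear function into one with a kink, but it does not push the second
difference beyond a bound that also dominates the two first differences. -/
lemma abs_secondDiff_relu_le {a b e c : ℝ} (hab : |a - b| ≤ c) (heb : |e - b| ≤ c)
    (h : |(a - b) + (e - b)| ≤ c) :
    |(relu a - relu b) + (relu e - relu b)| ≤ c := by
  simp only [relu]
  rw [abs_le] at *
  rcases max_cases a 0 with ha | ha <;> rcases max_cases b 0 with hb | hb <;>
    rcases max_cases e 0 with he | he <;> rw [ha.1, hb.1, he.1] <;> constructor <;> linarith

namespace FeedForwardNet

lemma norm_eval_sub_eval_le {d n : ℕ} (Φ : FeedForwardNet d n) (hΦ : Φ.InftyNormConstrained)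
    (x y : Fin d → ℝ) : ‖Φ.eval relu x - Φ.eval relu y‖ ≤ ‖x - y‖ := by
  induction Φ with
  | affine W b =>
    simp only [eval, add_sub_add_right_eq_sub, ← Matrix.mulVec_sub]
    exact norm_mulVec_le_of_matrixInftyNorm_le_one hΦ _
  | layer Φ W b ih =>
    simp only [eval, add_sub_add_right_eq_sub, ← Matrix.mulVec_sub]
    refine (norm_mulVec_le_of_matrixInftyNorm_le_one hΦ.2 _).trans
      ((pi_norm_le_iff_of_nonneg (norm_nonneg _)).2 fun j => ?_)
    exact (abs_relu_sub_relu_le _ _).trans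
      ((norm_le_pi_norm (Φ.eval relu x - Φ.eval relu y) j).trans (ih hΦ.1))

lemma norm_secondDiff_eval_le {d n : ℕ} (Φ : FeedForwardNet d n) (hΦ : Φ.InftyNormConstrained)
    {x y z : Fin d → ℝ} {c : ℝ} (hxy : ‖x - y‖ ≤ c) (hzy : ‖z - y‖ ≤ c)
    (h : ‖(x - y) + (z - y)‖ ≤ c) :
    ‖(Φ.eval relu x - Φ.eval relu y) + (Φ.eval relu z - Φ.eval relu y)‖ ≤ c := by
  induction Φ with
  | affine W b =>
    simp only [eval, add_sub_add_right_eq_sub, ← Matrix.mulVec_sub, ← Matrix.mulVec_add]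
    exact (norm_mulVec_le_of_matrixInftyNorm_le_one hΦ _).trans h
  | layer Φ W b ih =>
    simp only [eval, add_sub_add_right_eq_sub, ← Matrix.mulVec_sub, ← Matrix.mulVec_add]
    refine (norm_mulVec_le_of_matrixInftyNorm_le_one hΦ.2 _).trans
      ((pi_norm_le_iff_of_nonneg ((norm_nonneg _).trans h)).2 fun j => ?_)
    exact abs_secondDiff_relu_le
      ((norm_le_pi_norm (Φ.eval relu x - Φ.eval relu y) j).trans
        ((norm_eval_sub_eval_le Φ hΦ.1 x y).trans hxy))
      ((norm_le_pi_norm (Φ.eval relu z - Φ.eval relu y) j).trans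
        ((norm_eval_sub_eval_le Φ hΦ.1 z y).trans hzy))
      ((norm_le_pi_norm _ j).trans (ih hΦ.1))

end FeedForwardNet

/-! ### Triples with a strict triangle inequality -/

/-- A coloring of the pairs `n < m` of natural numbers with finitely many colors has two
consecutive pairs of the same color. -/
lemma exists_lt_lt_color_eq {κ : Type*} [Finite κ] (color : ℕ → ℕ → κ) :
    ∃ n m k, n < m ∧ m < k ∧ color n m = color m k := by
  -- Two indices `n < m` see the same set of colors to their right, so `m` sees `color n m`.
  let T : ℕ → Set κ := fun n => color n '' Set.Ioi n
  obtain ⟨n, m, hnm, hT⟩ : ∃ n m, n < m ∧ T n = T m := by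
    obtain ⟨n, m, hne, hT⟩ := Finite.exists_ne_map_eq_of_infinite T
    rcases hne.lt_or_gt with hlt | hlt
    exacts [⟨n, m, hlt, hT⟩, ⟨m, n, hlt, hT.symm⟩]
  have hmem : color n m ∈ T m := hT ▸ Set.mem_image_of_mem (color n) hnm
  obtain ⟨k, hmk, hk⟩ := hmem
  exact ⟨n, m, k, hnm, hmk, hk.symm⟩

/-- Equality in the triangle inequality for the maximum norm forces the two vectors to attain
their norms in a common coordinate and with a common sign. -/
lemma exists_coord_of_norm_add_norm_le {d : ℕ} [Nonempty (Fin d)] {u v : Fin d → ℝ}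
    (h : ‖u‖ + ‖v‖ ≤ ‖u + v‖) :
    ∃ i, (u i = ‖u‖ ∧ v i = ‖v‖) ∨ (-u i = ‖u‖ ∧ -v i = ‖v‖) := by
  obtain ⟨i, hi⟩ : ∃ i, ‖u + v‖ ≤ |u i + v i| := by
    by_contra! hlt
    exact lt_irrefl _ ((pi_norm_lt_iff
      ((abs_nonneg _).trans_lt (hlt (Classical.arbitrary _)))).2 hlt)
  have hu := abs_le.1 (norm_le_pi_norm u i)
  have hv := abs_le.1 (norm_le_pi_norm v i)
  refine ⟨i, ?_⟩
  rcases abs_cases (u i + v i) with hs | hs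
  · left; constructor <;> linarith
  · right; constructor <;> linarith

lemma exists_norm_add_lt_of_infinite {d : ℕ} {D : Set (Fin d → ℝ)} (hinf : D.Infinite) :
    ∃ x ∈ D, ∃ y ∈ D, ∃ z ∈ D, x ≠ y ∧ z ≠ y ∧ ‖(x - y) + (z - y)‖ < ‖x - y‖ + ‖z - y‖ := by
  let p : ℕ → Fin d → ℝ := fun n => hinf.natEmbedding D n
  have hpD : ∀ n, p n ∈ D := fun n => (hinf.natEmbedding D n).2
  have hp : Function.Injective p :=
    Subtype.val_injective.comp (hinf.natEmbedding D).injective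
  have : Nonempty (Fin d) := by
    by_contra hempty
    rw [not_nonempty_iff] at hempty
    exact zero_ne_one (hp (Subsingleton.elim (p 0) (p 1)))
  obtain ⟨n, m, k, hnm, hmk, hcolor⟩ := exists_lt_lt_color_eq fun n m =>
    (({i | (p m - p n) i = ‖p m - p n‖}, {i | -(p m - p n) i = ‖p m - p n‖}) :
      Set (Fin d) × Set (Fin d))
  rw [Prod.mk.injEq] at hcolor
  refine ⟨p n, hpD n, p m, hpD m, p k, hpD k, hp.ne hnm.ne, hp.ne hmk.ne', ?_⟩
  have hpos : 0 < ‖p k - p m‖ := norm_pos_iff.2 (sub_ne_zero.2 (hp.ne hmk.ne'))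
  by_contra! hle
  obtain ⟨i, ⟨hu, hv⟩ | ⟨hu, hv⟩⟩ := exists_coord_of_norm_add_norm_le hle
  · have hi : i ∈ {i | -(p m - p n) i = ‖p m - p n‖} := by
      rw [Set.mem_ofPred_eq, norm_sub_rev, ← hu]
      simp
    rw [hcolor.2, Set.mem_ofPred_eq] at hi
    linarith
  · have hi : i ∈ {i | (p m - p n) i = ‖p m - p n‖} := by
      rw [Set.mem_ofPred_eq, norm_sub_rev, ← hu]
      simp
    rw [hcolor.1, Set.mem_ofPred_eq] at hi
    linarith

/-! ### A Lipschitz function that is not approximable -/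

theorem proposition4 (d : ℕ) (D : Set (Fin d → ℝ)) (hD : IsCompact D) (hinf : D.Infinite) :
    ∃ f ∈ LipOneInfty D,
      ¬ ∀ ε : ℝ, 0 < ε →
        ∃ Φ : FeedForwardNet d 1, Φ.InftyNormConstrained ∧
          ∀ x : D, |Φ.eval relu (x : Fin d → ℝ) 0 - f x| ≤ ε := by
  obtain ⟨x, hx, y, hy, z, hz, hxy, hzy, hlt⟩ := exists_norm_add_lt_of_infinite hinf
  refine ⟨fun p => ‖(p : Fin d → ℝ) - y‖, fun p q => ?_, fun happrox => ?_⟩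
  · simpa using abs_norm_sub_norm_le ((p : Fin d → ℝ) - y) (q - y)
  have hx0 : 0 < ‖x - y‖ := norm_pos_iff.2 (sub_ne_zero.2 hxy)
  have hz0 : 0 < ‖z - y‖ := norm_pos_iff.2 (sub_ne_zero.2 hzy)
  obtain ⟨c, hc, hc_lt⟩ : ∃ c, max (max ‖x - y‖ ‖z - y‖) ‖(x - y) + (z - y)‖ ≤ c ∧
      c < ‖x - y‖ + ‖z - y‖ :=
    ⟨_, le_rfl, max_lt (max_lt (by linarith) (by linarith)) hlt⟩
  simp only [max_le_iff] at hc
  -- The second difference of an `ε`-approximation deviates from that of `f` by at most `4 * ε`,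
  -- so a fifth of the gap between `c` and the second difference of `f` is small enough.
  obtain ⟨Φ, hΦ, hε⟩ := happrox ((‖x - y‖ + ‖z - y‖ - c) / 5) (by linarith)
  have hΦc : |(Φ.eval relu x 0 - Φ.eval relu y 0) + (Φ.eval relu z 0 - Φ.eval relu y 0)| ≤ c :=
    (norm_le_pi_norm _ 0).trans (Φ.norm_secondDiff_eval_le hΦ hc.1.1 hc.1.2 hc.2)
  have h1 := abs_le.1 (hε ⟨x, hx⟩)
  have h2 := abs_le.1 (hε ⟨y, hy⟩)
  have h3 := abs_le.1 (hε ⟨z, hz⟩)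
  simp only [sub_self, norm_zero, sub_zero] at h1 h2 h3
  linarith [abs_le.1 hΦc]
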